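/- Let $\mathcal W_2(\mathbb R)$ be the set of Borel probability measures on $\mathbb R$ with finite second moment, with the quadratic Wasserstein distance $$W_2(\mu,\nu)=\Big(\inf_{\pi\in\Pi(\mu,\nu)}\int |x-y|^2\,d\pi(x,y)\Big)^{1/2},$$ where $\Pi(\mu,\nu)$ is the set of probability measures on $\mathbb R\times\mathbb R$ with marginals $\mu$ and $\nu$. For $H\in\mathbb R$ let $W_2^{2H}$ be the kernel $(\mu,\nu)\mapsto W_2(\mu,\nu)^{2H}$, with $0^0=1$ (so that $W_2^0$ is the constant kernel $1$) and with the value $0$ on the diagonal if $H<0$. For a set $E$ and $K:E\times E\to\mathbb R$ consider the condition $$(\ast)\qquad \sum_{i,j=1}^n c_ic_jK(x_i,x_j)\le 0\quad\text{for all } n,\ x_1,\dots,x_n\in E,\ c_1,\dots,c_n\in\mathbb R \text{ with } \sum_{i=1}^n c_i=0 .$$ $K$ is called a negative definite kernel if $K(x,x)=0$ for all $x\in E$ and $(\ast)$ holds; a kernel with $(\ast)$ is called nondegenerate if the inequality in $(\ast)$ is strict whenever the $x_i$ are pairwise distinct and the $c_i$ are not all zero. The fractional index of $E$ with distance $d$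 is $\beta_E=\sup\{\beta>0 : d^\beta \text{ is a negative definite kernel}\}\in[0,\infty]$. Theorem. Let $H\in\mathbb R$. 1. $W_2^{2H}$ satisfies $(\ast)$ if and only if $0\le H\le 1$. For $H\neq 0$ it is a negative definite kernel if and only if $0\le H\le 1$ (for $H=0$ it is the constant kernel $1$, which satisfies $(\ast)$ but does not vanish on the diagonal). 2. $W_2^{2H}$ satisfies $(\ast)$ and is nondegenerate if and only if $0<H<1$; likewise, it is a nondegenerate negative definite kernel if and only if $0<H<1$. 3. The fractional index of $\mathcal W_2(\mathbb R)$ equals $2$. -/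

import Mathlib

open MeasureTheory
open scoped ENNReal

noncomputable section

namespace WassersteinKernel

/-- The set of Borel probability measures on `ℝ` with finite second moment. -/
def W₂Space : Type :=
  {μ : ProbabilityMeasure ℝ // Integrable (fun x : ℝ => x ^ 2) (μ : Measure ℝ)}

/-- The measure underlying an element of `W₂Space`. -/
def W₂Space.toMeasure (μ : W₂Space) : Measure ℝ := (μ.1 : Measure ℝ)

/-- `Π(μ, ν)`: the measures on `ℝ × ℝ` with marginals `μ` and `ν`
(such a measure is automatically a probability measure if `μ` is one). -/
def couplings (μ ν : Measure ℝ) : Set (Measure (ℝ × ℝ)) :=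
  {π | π.map Prod.fst = μ ∧ π.map Prod.snd = ν}

/-- The quadratic transportation cost. -/
def transportCost (μ ν : Measure ℝ) : ℝ≥0∞ :=
  ⨅ π ∈ couplings μ ν, ∫⁻ p, ENNReal.ofReal (|p.1 - p.2| ^ 2) ∂π

/-- The quadratic Wasserstein distance. On `W₂Space` the transportation cost is finite, the product
measure being a coupling of finite cost. -/
def W₂ (μ ν : W₂Space) : ℝ :=
  Real.sqrt (transportCost μ.toMeasure ν.toMeasure).toReal

/-- The power `d ^ s` of a nonnegative kernel. Mathlib's conventions apply: `0 ^ 0 = 1`, so that the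
power with exponent `0` is the constant kernel `1`, and `0 ^ s = 0` for every `s ≠ 0`. -/
def kernelPow {E : Type*} (d : E → E → ℝ) (s : ℝ) : E → E → ℝ :=
  fun x y => d x y ^ s

/-- The inequality that characterizes negative definite kernels. -/
def NegativeInequality {E : Type*} (K : E → E → ℝ) : Prop :=
  ∀ (n : ℕ) (x : Fin n → E) (c : Fin n → ℝ), ∑ i, c i = 0 →
    ∑ i, ∑ j, c i * c j * K (x i) (x j) ≤ 0

/-- The same inequality, strict for pairwise distinct points and coefficients not all zero. -/
def StrictNegativeInequality {E : Type*} (K : E → E → ℝ) : Prop :=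
  ∀ (n : ℕ) (x : Fin n → E) (c : Fin n → ℝ), Function.Injective x → c ≠ 0 → ∑ i, c i = 0 →
    ∑ i, ∑ j, c i * c j * K (x i) (x j) < 0

/-- Negative definite kernels, including the requirement that they vanish on the diagonal. -/
def IsNegativeDefinite {E : Type*} (K : E → E → ℝ) : Prop :=
  (∀ x, K x x = 0) ∧ NegativeInequality K

/-- Nondegenerate negative definite kernels. -/
def IsNondegenerateNegativeDefinite {E : Type*} (K : E → E → ℝ) : Prop :=
  IsNegativeDefinite K ∧ StrictNegativeInequality K

/-- The fractional index of a space `E` with distance `d`: the supremum, in `[0, ∞]`, of the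
`β > 0` for which `d ^ β` is negative definite. -/
def fractionalIndex {E : Type*} (d : E → E → ℝ) : ℝ≥0∞ :=
  ⨆ β ∈ {β : ℝ | 0 < β ∧ IsNegativeDefinite (kernelPow d β)}, ENNReal.ofReal β

end WassersteinKernel

end

/-! On the line the monotone coupling is optimal, so `quantile` embeds `W₂Space` isometrically into
the Hilbert space `L²(0, 1)` (`W₂_eq_norm_sub`), and the bounds for `0 ≤ H ≤ 1` are Schoenberg's
theorem. For `0 < H < 1`, `t ^ H` is a positive multiple of `∫ (1 - exp (-r t)) r ^ (-1 - H) dr`.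
With `t = ‖x - y‖ ^ 2` and `∑ c i = 0`, the quadratic form becomes minus a mixture of Gaussian
forms. These are nonnegative for every `r ≥ 0` and, at distinct points, positive for large `r`,
which yields strictness. At `H = 1` the form is `-2 ‖∑ c i • x i‖ ^ 2`.

Conversely, point masses embed `ℝ` isometrically, and three of them refute `H < 0` and `H > 1` and
show degeneracy at `H = 1`. At `H = 0` the form vanishes identically. -/

namespace WassersteinKernel

/-! ### Positivity of Gaussian kernels -/

section Gaussian

variable {V : Type*} [NormedAddCommGroup V] {ι : Type*} [Fintype ι]

open Filter Topology in
/-- At distinct points the Gaussian kernel tends to the identity matrix as it concentrates. -/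
theorem eventually_sum_mul_gaussian_pos {x : ι → V} (hx : Function.Injective x) {c : ι → ℝ}
    (hc : c ≠ 0) :
    ∀ᶠ r : ℝ in atTop, 0 < ∑ i, ∑ j, c i * c j * Real.exp (-(r * ‖x i - x j‖ ^ 2)) := by
  classical
  have hlim : Tendsto (fun r : ℝ => ∑ i, ∑ j, c i * c j * Real.exp (-(r * ‖x i - x j‖ ^ 2))) atTop
      (𝓝 (∑ i, ∑ j, c i * c j * (if i = j then 1 else 0))) := by
    refine tendsto_finsetSum _ fun i _ => tendsto_finsetSum _ fun j _ => Tendsto.const_mul _ ?_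
    by_cases hij : i = j
    · simp [hij]
    · have hpos : 0 < ‖x i - x j‖ ^ 2 := by
        have := norm_pos_iff.2 (sub_ne_zero.2 (hx.ne hij))
        positivity
      rw [if_neg hij]
      exact Real.tendsto_exp_neg_atTop_nhds_zero.comp (tendsto_id.atTop_mul_const hpos)
  refine hlim.eventually (lt_mem_nhds ?_)
  simp only [mul_ite, mul_one, mul_zero, Finset.sum_ite_eq, Finset.mem_univ, if_true]
  obtain ⟨i, hi⟩ := Function.ne_iff.1 hc
  exact Finset.sum_pos' (fun j _ => mul_self_nonneg _) ⟨i, Finset.mem_univ i, mul_self_pos.2 hi⟩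

variable [InnerProductSpace ℝ V]

-- Schur product theorem: these are Hadamard powers of a Gram matrix, starting from the all-ones
-- matrix.
open Matrix in
theorem posSemidef_inner_pow (x : ι → V) (k : ℕ) :
    (Matrix.of fun i j => (inner ℝ (x i) (x j)) ^ k).PosSemidef := by
  induction k with
  | zero =>
    have e : (of fun i j => (inner ℝ (x i) (x j)) ^ 0) = gram ℝ (fun _ : ι => (1 : ℝ)) := by
      ext i j
      simp [gram_apply]
    rw [e]
    exact posSemidef_gram ℝ _
  | succ k ih =>
    have e : (of fun i j => (inner ℝ (x i) (x j)) ^ (k + 1)) =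
        (of fun i j => (inner ℝ (x i) (x j)) ^ k) ⊙ gram ℝ x := by
      ext i j
      simp [gram_apply, pow_succ]
    rw [e]
    exact ih.hadamard (posSemidef_gram ℝ x)

theorem sum_mul_inner_pow_nonneg (x : ι → V) (c : ι → ℝ) (k : ℕ) :
    0 ≤ ∑ i, ∑ j, c i * c j * (inner ℝ (x i) (x j)) ^ k := by
  have h := (posSemidef_inner_pow x k).dotProduct_mulVec_nonneg c
  simp only [dotProduct, Matrix.mulVec, Matrix.of_apply, Pi.star_apply, star_trivial,
    Finset.mul_sum] at h
  refine h.trans_eq (Finset.sum_congr rfl fun i _ => Finset.sum_congr rfl fun j _ => by ring)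

theorem sum_mul_exp_inner_nonneg (x : ι → V) (c : ι → ℝ) {r : ℝ} (hr : 0 ≤ r) :
    0 ≤ ∑ i, ∑ j, c i * c j * Real.exp (r * inner ℝ (x i) (x j)) := by
  have h : HasSum (fun k : ℕ => ∑ i, ∑ j, c i * c j * ((r * inner ℝ (x i) (x j)) ^ k / k.factorial))
      (∑ i, ∑ j, c i * c j * Real.exp (r * inner ℝ (x i) (x j))) := by
    refine hasSum_sum fun i _ => hasSum_sum fun j _ => HasSum.mul_left _ ?_
    rw [Real.exp_eq_exp_ℝ]
    exact NormedSpace.expSeries_div_hasSum_exp _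
  refine h.nonneg fun k => ?_
  have e : ∑ i, ∑ j, c i * c j * ((r * inner ℝ (x i) (x j)) ^ k / k.factorial) =
      r ^ k / k.factorial * ∑ i, ∑ j, c i * c j * (inner ℝ (x i) (x j)) ^ k := by
    simp only [Finset.mul_sum]
    refine Finset.sum_congr rfl fun i _ => Finset.sum_congr rfl fun j _ => ?_
    rw [mul_pow]
    ring
  rw [e]
  exact mul_nonneg (by positivity) (sum_mul_inner_pow_nonneg x c k)

/-- The Gaussian kernel is positive semidefinite. -/
theorem sum_mul_gaussian_nonneg (x : ι → V) (c : ι → ℝ) {r : ℝ} (hr : 0 ≤ r) :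
    0 ≤ ∑ i, ∑ j, c i * c j * Real.exp (-(r * ‖x i - x j‖ ^ 2)) := by
  -- Expanding the square, the factors `exp (-(r * ‖x i‖ ^ 2))` are absorbed into the coefficients.
  refine (sum_mul_exp_inner_nonneg x (fun i => c i * Real.exp (-(r * ‖x i‖ ^ 2)))
    (mul_nonneg zero_le_two hr)).trans_eq ?_
  refine Finset.sum_congr rfl fun i _ => Finset.sum_congr rfl fun j _ => ?_
  have e : -(r * ‖x i - x j‖ ^ 2) =
      -(r * ‖x i‖ ^ 2) + -(r * ‖x j‖ ^ 2) + 2 * r * inner ℝ (x i) (x j) := by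
    rw [norm_sub_sq_real]
    ring
  rw [e, Real.exp_add, Real.exp_add]
  ring

end Gaussian

/-! ### Fractional powers as mixtures of Gaussians -/

section Subordination

/-- Near `0` the bound `1 - exp (-(r * t)) ≤ r * t` leaves `r ^ (-H)`, integrable as `H < 1`; at
infinity the bound `1` leaves `r ^ (-1 - H)`, integrable as `0 < H`. -/
theorem integrableOn_one_sub_exp_mul_rpow {H : ℝ} (h0 : 0 < H) (h1 : H < 1) {t : ℝ} (ht : 0 ≤ t) :
    IntegrableOn (fun r : ℝ => (1 - Real.exp (-(r * t))) * r ^ (-1 - H)) (Set.Ioi 0) := by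
  have hmeas : Measurable fun r : ℝ => (1 - Real.exp (-(r * t))) * r ^ (-1 - H) := by fun_prop
  have hle : ∀ r : ℝ, 0 < r → ‖1 - Real.exp (-(r * t))‖ ≤ r * t ∧
      ‖1 - Real.exp (-(r * t))‖ ≤ 1 := by
    intro r hr
    have h₁ := Real.add_one_le_exp (-(r * t))
    have h₂ : Real.exp (-(r * t)) ≤ 1 := Real.exp_le_one_iff.2 (by nlinarith)
    have h₃ := Real.exp_pos (-(r * t))
    rw [Real.norm_of_nonneg (by linarith)]
    constructor <;> linarith
  rw [← Set.Ioc_union_Ioi_eq_Ioi zero_le_one]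
  refine IntegrableOn.union ?_ ?_
  · have hI : IntegrableOn (fun r : ℝ => t * r ^ (-H)) (Set.Ioc 0 1) :=
      ((intervalIntegrable_iff_integrableOn_Ioc_of_le zero_le_one).1
        (intervalIntegral.intervalIntegrable_rpow' (by linarith))).const_mul t
    refine hI.mono' hmeas.aestronglyMeasurable ?_
    filter_upwards [ae_restrict_mem measurableSet_Ioc] with r hr
    have hr0 : 0 < r := hr.1
    rw [norm_mul, Real.norm_of_nonneg (Real.rpow_nonneg hr0.le _)]
    calc _ ≤ r * t * r ^ (-1 - H) :=
          mul_le_mul_of_nonneg_right (hle r hr0).1 (Real.rpow_nonneg hr0.le _)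
      _ = t * r ^ (-H) := by
          rw [show -H = 1 + (-1 - H) by ring, Real.rpow_add hr0, Real.rpow_one]
          ring
  · refine (integrableOn_Ioi_rpow_of_lt (a := -1 - H) (by linarith) one_pos).mono'
      hmeas.aestronglyMeasurable ?_
    filter_upwards [ae_restrict_mem measurableSet_Ioi] with r hr
    have hr0 : 0 < r := one_pos.trans hr
    rw [norm_mul, Real.norm_of_nonneg (Real.rpow_nonneg hr0.le _)]
    exact mul_le_of_le_one_left (Real.rpow_nonneg hr0.le _) (hle r hr0).2

theorem integral_one_sub_exp_mul_rpow {H : ℝ} (h0 : 0 < H) {t : ℝ} (ht : 0 ≤ t) :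
    ∫ r in Set.Ioi (0 : ℝ), (1 - Real.exp (-(r * t))) * r ^ (-1 - H) =
      t ^ H * ∫ r in Set.Ioi (0 : ℝ), (1 - Real.exp (-r)) * r ^ (-1 - H) := by
  rcases ht.eq_or_lt with rfl | ht
  · simp [Real.zero_rpow h0.ne']
  · have h := integral_comp_mul_left_Ioi
      (fun r : ℝ => (1 - Real.exp (-r)) * r ^ (-1 - H)) 0 ht
    rw [mul_zero, smul_eq_mul] at h
    have e : ∫ r in Set.Ioi (0 : ℝ), (1 - Real.exp (-(t * r))) * (t * r) ^ (-1 - H) =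
        t ^ (-1 - H) * ∫ r in Set.Ioi (0 : ℝ), (1 - Real.exp (-(r * t))) * r ^ (-1 - H) := by
      rw [← integral_const_mul]
      refine setIntegral_congr_fun measurableSet_Ioi fun r hr => ?_
      rw [Real.mul_rpow ht.le (le_of_lt hr), mul_comm t r]
      ring
    rw [e] at h
    have hpow : t ^ H * t = (t ^ (-1 - H))⁻¹ := by
      rw [← Real.rpow_neg ht.le, show -(-1 - H) = H + 1 by ring, Real.rpow_add_one ht.ne']
    have hne : t ^ (-1 - H) ≠ 0 := (Real.rpow_pos_of_pos ht _).ne'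
    rw [← mul_right_inj' hne, h]
    rw [inv_eq_one_div, eq_div_iff hne] at hpow
    field_simp
    linear_combination -(∫ r in Set.Ioi (0 : ℝ), (1 - Real.exp (-r)) * r ^ (-1 - H)) * hpow

variable {V : Type*} [NormedAddCommGroup V] {ι : Type*} [Fintype ι]

theorem integral_one_sub_exp_neg_mul_rpow_pos {H : ℝ} (h0 : 0 < H) (h1 : H < 1) :
    0 < ∫ r in Set.Ioi (0 : ℝ), (1 - Real.exp (-r)) * r ^ (-1 - H) := by
  have hpos : ∀ r ∈ Set.Ioi (0 : ℝ), 0 < (1 - Real.exp (-r)) * r ^ (-1 - H) := fun r hr =>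
    mul_pos (sub_pos.2 (Real.exp_lt_one_iff.2 (neg_neg_iff_pos.2 hr))) (Real.rpow_pos_of_pos hr _)
  have hint := integrableOn_one_sub_exp_mul_rpow h0 h1 zero_le_one
  simp only [mul_one] at hint
  rw [setIntegral_pos_iff_support_of_nonneg_ae _ hint]
  · refine lt_of_lt_of_le ?_ (measure_mono (s := Set.Ioi (0 : ℝ)) fun r hr =>
      ⟨(hpos r hr).ne', hr⟩)
    simp
  · filter_upwards [ae_restrict_mem measurableSet_Ioi] with r hr
    exact (hpos r hr).le

/-- The quadratic form of the Gaussian kernel with parameter `r`, weighted by `r ^ (-1 - H)`. -/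
noncomputable def gaussianForm (H : ℝ) (x : ι → V) (c : ι → ℝ) (r : ℝ) : ℝ :=
  (∑ i, ∑ j, c i * c j * Real.exp (-(r * ‖x i - x j‖ ^ 2))) * r ^ (-1 - H)

/-- As `∑ c i = 0`, the constant `1` can be inserted at no cost; it compensates the singularity of
the weight at `r = 0`. -/
theorem neg_gaussianForm (H : ℝ) (x : ι → V) {c : ι → ℝ} (hsum : ∑ i, c i = 0) (r : ℝ) :
    -gaussianForm H x c r = ∑ i, ∑ j, c i * c j *
      ((1 - Real.exp (-(r * ‖x i - x j‖ ^ 2))) * r ^ (-1 - H)) := by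
  have hz : ∑ i, ∑ j, c i * c j = 0 := by
    rw [← Finset.sum_mul_sum, hsum, zero_mul]
  have : ∑ i, ∑ j, c i * c j * ((1 - Real.exp (-(r * ‖x i - x j‖ ^ 2))) * r ^ (-1 - H)) =
      (∑ i, ∑ j, c i * c j) * r ^ (-1 - H) - gaussianForm H x c r := by
    simp only [gaussianForm, Finset.sum_mul, ← Finset.sum_sub_distrib]
    exact Finset.sum_congr rfl fun i _ => Finset.sum_congr rfl fun j _ => by ring
  rw [this, hz, zero_mul, zero_sub]

theorem gaussianForm_nonneg [InnerProductSpace ℝ V] (H : ℝ) (x : ι → V) (c : ι → ℝ) {r : ℝ} (hr : 0 ≤ r) :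
    0 ≤ gaussianForm H x c r :=
  mul_nonneg (sum_mul_gaussian_nonneg x c hr) (Real.rpow_nonneg hr _)

theorem integrableOn_gaussianForm {H : ℝ} (h0 : 0 < H) (h1 : H < 1) (x : ι → V) {c : ι → ℝ}
    (hsum : ∑ i, c i = 0) : IntegrableOn (gaussianForm H x c) (Set.Ioi 0) := by
  have : IntegrableOn (fun r => -gaussianForm H x c r) (Set.Ioi 0) := by
    simp only [neg_gaussianForm H x hsum]
    exact integrable_finsetSum _ fun i _ => integrable_finsetSum _ fun j _ =>
      (integrableOn_one_sub_exp_mul_rpow h0 h1 (sq_nonneg ‖x i - x j‖)).const_mul _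
  simpa using this.neg

theorem sum_mul_norm_sub_rpow_mul_integral {H : ℝ} (h0 : 0 < H) (h1 : H < 1) (x : ι → V)
    {c : ι → ℝ} (hsum : ∑ i, c i = 0) :
    (∑ i, ∑ j, c i * c j * ‖x i - x j‖ ^ (2 * H)) *
        (∫ r in Set.Ioi (0 : ℝ), (1 - Real.exp (-r)) * r ^ (-1 - H)) =
      -∫ r in Set.Ioi (0 : ℝ), gaussianForm H x c r := by
  have hint : ∀ i j, Integrable (fun r : ℝ => c i * c j *
      ((1 - Real.exp (-(r * ‖x i - x j‖ ^ 2))) * r ^ (-1 - H)))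
      (volume.restrict (Set.Ioi 0)) := fun i j =>
    (integrableOn_one_sub_exp_mul_rpow h0 h1 (sq_nonneg ‖x i - x j‖)).const_mul _
  rw [← integral_neg]
  simp only [neg_gaussianForm H x hsum]
  rw [integral_finsetSum _ fun i _ => integrable_finsetSum _ fun j _ => hint i j, Finset.sum_mul]
  refine Finset.sum_congr rfl fun i _ => ?_
  rw [integral_finsetSum _ fun j _ => hint i j, Finset.sum_mul]
  refine Finset.sum_congr rfl fun j _ => ?_
  rw [integral_const_mul, integral_one_sub_exp_mul_rpow h0 (sq_nonneg _),
    ← Real.rpow_natCast_mul (norm_nonneg _)]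
  push_cast
  ring

theorem sum_mul_norm_sub_rpow_nonpos [InnerProductSpace ℝ V] {H : ℝ} (h0 : 0 < H) (h1 : H < 1) (x : ι → V)
    {c : ι → ℝ} (hsum : ∑ i, c i = 0) :
    ∑ i, ∑ j, c i * c j * ‖x i - x j‖ ^ (2 * H) ≤ 0 := by
  refine nonpos_of_mul_nonpos_left ?_ (integral_one_sub_exp_neg_mul_rpow_pos h0 h1)
  rw [sum_mul_norm_sub_rpow_mul_integral h0 h1 x hsum, neg_nonpos]
  exact setIntegral_nonneg measurableSet_Ioi fun r hr => gaussianForm_nonneg H x c (le_of_lt hr)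

theorem sum_mul_norm_sub_rpow_neg [InnerProductSpace ℝ V] {H : ℝ} (h0 : 0 < H) (h1 : H < 1) {x : ι → V}
    (hx : Function.Injective x) {c : ι → ℝ} (hc : c ≠ 0) (hsum : ∑ i, c i = 0) :
    ∑ i, ∑ j, c i * c j * ‖x i - x j‖ ^ (2 * H) < 0 := by
  refine neg_of_mul_neg_left ?_ (integral_one_sub_exp_neg_mul_rpow_pos h0 h1).le
  rw [sum_mul_norm_sub_rpow_mul_integral h0 h1 x hsum, neg_lt_zero,
    setIntegral_pos_iff_support_of_nonneg_ae _ (integrableOn_gaussianForm h0 h1 x hsum)]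
  · obtain ⟨R, hR⟩ := Filter.eventually_atTop.1 (eventually_sum_mul_gaussian_pos hx hc)
    -- The nonnegative integrand is positive on a whole half-line, a set of positive measure.
    have hsub : Set.Ioi (max R 0) ⊆ Function.support (gaussianForm H x c) ∩ Set.Ioi 0 := by
      intro r hr
      have hr0 : 0 < r := (le_max_right _ _).trans_lt hr
      exact ⟨(mul_pos (hR r ((le_max_left _ _).trans hr.le)) (Real.rpow_pos_of_pos hr0 _)).ne',
        hr0⟩
    refine lt_of_lt_of_le ?_ (measure_mono hsub)
    simp
  · filter_upwards [ae_restrict_mem measurableSet_Ioi] with r hr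
    exact gaussianForm_nonneg H x c (le_of_lt hr)

theorem sum_mul_norm_sub_sq [InnerProductSpace ℝ V] (x : ι → V) {c : ι → ℝ} (hsum : ∑ i, c i = 0) :
    ∑ i, ∑ j, c i * c j * ‖x i - x j‖ ^ 2 = -2 * ‖∑ i, c i • x i‖ ^ 2 := by
  rw [← real_inner_self_eq_norm_sq, sum_inner]
  simp only [inner_sum, real_inner_smul_left, real_inner_smul_right, norm_sub_sq_real]
  have e : ∀ i j, c i * c j * (‖x i‖ ^ 2 - 2 * inner ℝ (x i) (x j) + ‖x j‖ ^ 2) =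
      (c i * ‖x i‖ ^ 2) * c j + c i * (c j * ‖x j‖ ^ 2) +
        -2 * (c j * (c i * inner ℝ (x i) (x j))) := fun i j => by ring
  simp only [e, Finset.sum_add_distrib, ← Finset.mul_sum, ← Finset.sum_mul, hsum]
  simp

end Subordination

end WassersteinKernel

noncomputable section

namespace WassersteinKernel

open Set

/-! ### The quadratic cost as an integral over quadrants -/

section Layers

theorem measurableSet_setOf_lt_and_le {α : Type*} [MeasurableSpace α] {f g h k : α → ℝ}
    (hf : Measurable f) (hg : Measurable g) (hh : Measurable h) (hk : Measurable k) :
    MeasurableSet {a | f a < g a ∧ h a ≤ k a} :=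
  (measurableSet_lt hf hg).inter (measurableSet_le hh hk)

/-- The squared distance is the area of a square; of the two squares, one is always empty. -/
theorem ofReal_abs_sub_sq_eq_volume (x y : ℝ) :
    ENNReal.ofReal (|x - y| ^ 2) =
      (volume : Measure (ℝ × ℝ)) (Ioc x y ×ˢ Ioc x y) + volume (Ioc y x ×ˢ Ioc y x) := by
  have h : ∀ a b : ℝ, a ≤ b → ENNReal.ofReal (|a - b| ^ 2) =
      (volume : Measure (ℝ × ℝ)) (Ioc a b ×ˢ Ioc a b) + volume (Ioc b a ×ˢ Ioc b a) := by
    intro a b hab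
    rw [Ioc_eq_empty (not_lt.2 hab), empty_prod, measure_empty, add_zero, Measure.volume_eq_prod,
      Measure.prod_prod, Real.volume_Ioc, ← ENNReal.ofReal_mul (sub_nonneg.2 hab), sq_abs]
    congr 1
    ring
  rcases le_total x y with hxy | hxy
  · exact h x y hxy
  · rw [abs_sub_comm, add_comm]
    exact h y x hxy

theorem lintegral_volume_Ioc_prod (π : Measure (ℝ × ℝ)) [SFinite π] {f g : ℝ × ℝ → ℝ}
    (hf : Measurable f) (hg : Measurable g) :
    ∫⁻ p, (volume : Measure (ℝ × ℝ)) (Ioc (f p) (g p) ×ˢ Ioc (f p) (g p)) ∂π =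
      ∫⁻ z : ℝ × ℝ, π {p | f p < min z.1 z.2 ∧ max z.1 z.2 ≤ g p} := by
  set S : Set ((ℝ × ℝ) × (ℝ × ℝ)) :=
    {q | f q.1 < min q.2.1 q.2.2 ∧ max q.2.1 q.2.2 ≤ g q.1} with hS
  have hSm : MeasurableSet S :=
    measurableSet_setOf_lt_and_le (by fun_prop) (by fun_prop) (by fun_prop) (by fun_prop)
  have h₁ := Measure.prod_apply (μ := π) (ν := (volume : Measure (ℝ × ℝ))) hSm
  rw [Measure.prod_apply_symm hSm] at h₁
  refine Eq.trans (lintegral_congr fun p => ?_) h₁.symm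
  congr 1
  ext z
  simp only [hS, mem_prod, mem_Ioc, mem_preimage, mem_ofPred_eq, lt_min_iff, max_le_iff]
  tauto

/-- By Tonelli the cost depends on `π` only through its masses of quadrants, which can be compared
one by one between couplings. -/
theorem lintegral_abs_sub_sq (π : Measure (ℝ × ℝ)) [SFinite π] :
    ∫⁻ p, ENNReal.ofReal (|p.1 - p.2| ^ 2) ∂π =
      (∫⁻ z : ℝ × ℝ, π {p | p.1 < min z.1 z.2 ∧ max z.1 z.2 ≤ p.2}) +
      ∫⁻ z : ℝ × ℝ, π {p | p.2 < min z.1 z.2 ∧ max z.1 z.2 ≤ p.1} := by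
  rw [← lintegral_volume_Ioc_prod π measurable_fst measurable_snd,
    ← lintegral_volume_Ioc_prod π measurable_snd measurable_fst]
  simp only [ofReal_abs_sub_sq_eq_volume]
  refine lintegral_add_left ?_ _
  set S : Set ((ℝ × ℝ) × (ℝ × ℝ)) :=
    {q | q.2 ∈ Ioc q.1.1 q.1.2 ×ˢ Ioc q.1.1 q.1.2} with hS
  have hSm : MeasurableSet S := by
    have e : S = {q | q.1.1 < min q.2.1 q.2.2 ∧ max q.2.1 q.2.2 ≤ q.1.2} := by
      ext q
      simp only [hS, mem_prod, mem_Ioc, mem_ofPred_eq, lt_min_iff, max_le_iff]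
      tauto
    rw [e]
    exact measurableSet_setOf_lt_and_le (by fun_prop) (by fun_prop) (by fun_prop) (by fun_prop)
  exact measurable_measure_prodMk_left hSm

end Layers

/-! ### Quantile functions and optimality of the monotone coupling -/

section Quantile

/-- The open unit interval, which carries Lebesgue measure. -/
abbrev UnitIoo : Type := Ioo (0 : ℝ) 1

instance : MeasureSpace UnitIoo := Measure.Subtype.measureSpace

instance : IsProbabilityMeasure (volume : Measure UnitIoo) :=
  ⟨by rw [Measure.Subtype.volume_univ measurableSet_Ioo.nullMeasurableSet]; simp⟩

theorem volume_setOf_unitIoo_le {c : ℝ} (h1 : c ≤ 1) :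
    (volume : Measure UnitIoo) {u | (u : ℝ) ≤ c} = ENNReal.ofReal c := by
  rw [Measure.Subtype.volume_def,
    comap_subtype_coe_apply measurableSet_Ioo]
  have : (Subtype.val '' {u : UnitIoo | (u : ℝ) ≤ c}) = Ioo 0 1 ∩ Iic c := by
    ext x
    simp [and_comm]
  rw [this]
  refine le_antisymm ?_ ?_
  · refine (measure_mono (t := Ioc 0 c) fun x hx => ⟨hx.1.1, hx.2⟩).trans_eq (by simp)
  · refine Eq.trans_le (by simp) (measure_mono (s := Ioo 0 c) fun x hx =>
      ⟨⟨hx.1, hx.2.trans_le h1⟩, hx.2.le⟩)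

/-- The quantile function of a measure on the real line. -/
def quantile (μ : Measure ℝ) (u : UnitIoo) : ℝ := sInf {x | (u : ℝ) ≤ ProbabilityTheory.cdf μ x}

variable (μ ν : Measure ℝ)

/-- Right continuity of the distribution function makes the infimum attained; `0 < u < 1` makes the
set bounded below and nonempty. -/
theorem quantile_le_iff (u : UnitIoo) (x : ℝ) :
    quantile μ u ≤ x ↔ (u : ℝ) ≤ ProbabilityTheory.cdf μ x := by
  set S := {x | (u : ℝ) ≤ ProbabilityTheory.cdf μ x} with hS
  have hne : S.Nonempty :=
    ((ProbabilityTheory.tendsto_cdf_atTop μ).eventually (le_mem_nhds u.2.2)).exists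
  have hbdd : BddBelow S := by
    obtain ⟨a, ha⟩ := ((ProbabilityTheory.tendsto_cdf_atBot μ).eventually (gt_mem_nhds u.2.1)).exists
    refine ⟨a, fun y hy => le_of_not_gt fun hya => ?_⟩
    exact absurd (hy.trans (ProbabilityTheory.monotone_cdf μ hya.le)) (not_le.2 ha)
  refine ⟨fun h => ?_, fun h => csInf_le hbdd h⟩
  have hright : ∀ y, x < y → (u : ℝ) ≤ ProbabilityTheory.cdf μ y := by
    intro y hy
    obtain ⟨z, hz, hzy⟩ := (csInf_lt_iff hbdd hne).1 (lt_of_le_of_lt h hy)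
    exact le_trans hz (ProbabilityTheory.monotone_cdf μ hzy.le)
  have hlim := ((ProbabilityTheory.cdf μ).right_continuous x).tendsto.mono_left
    (nhdsWithin_mono x Ioi_subset_Ici_self)
  exact ge_of_tendsto hlim (Filter.eventually_of_mem self_mem_nhdsWithin hright)

theorem monotone_quantile : Monotone (quantile μ) := fun u v huv =>
  (quantile_le_iff μ u _).2
    (le_trans (Subtype.coe_le_coe.2 huv) ((quantile_le_iff μ v _).1 le_rfl))

theorem measurable_quantile : Measurable (quantile μ) := (monotone_quantile μ).measurable

theorem map_quantile [IsProbabilityMeasure μ] : volume.map (quantile μ) = μ := by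
  have := Measure.isProbabilityMeasure_map (μ := (volume : Measure UnitIoo))
    (measurable_quantile μ).aemeasurable
  refine Measure.ext_of_Iic _ _ fun x => ?_
  rw [Measure.map_apply (measurable_quantile μ) measurableSet_Iic, ← ProbabilityTheory.ofReal_cdf,
    ← volume_setOf_unitIoo_le (ProbabilityTheory.cdf_le_one μ x)]
  congr 1
  ext u
  exact quantile_le_iff μ u x

/-- The two sublevel sets are lower sets in a linear order, hence nested, so their difference has at
most the truncated difference of masses. Every coupling has at least that much
(`measure_Iio_sub_le_of_mem_couplings`). -/
theorem volume_lt_and_le_quantile_le [IsProbabilityMeasure μ] [IsProbabilityMeasure ν] (a b : ℝ) :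
    (volume : Measure UnitIoo) {u | quantile μ u < a ∧ b ≤ quantile ν u} ≤
      μ (Iio a) - ν (Iio b) := by
  have hA : μ (Iio a) = volume (quantile μ ⁻¹' Iio a) := by
    rw [← Measure.map_apply (measurable_quantile μ) measurableSet_Iio, map_quantile]
  have hB : ν (Iio b) = volume (quantile ν ⁻¹' Iio b) := by
    rw [← Measure.map_apply (measurable_quantile ν) measurableSet_Iio, map_quantile]
  have hset : {u | quantile μ u < a ∧ b ≤ quantile ν u} =
      (quantile μ ⁻¹' Iio a) \ (quantile ν ⁻¹' Iio b) := by
    ext u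
    simp
  have hlA : IsLowerSet (quantile μ ⁻¹' Iio a) := (isLowerSet_Iio a).preimage (monotone_quantile μ)
  have hlB : IsLowerSet (quantile ν ⁻¹' Iio b) := (isLowerSet_Iio b).preimage (monotone_quantile ν)
  rw [hset, hA, hB]
  rcases hlA.total hlB with h | h
  · rw [sdiff_eq_empty.2 h, measure_empty]
    exact zero_le
  · rw [measure_sdiff h (measurable_quantile ν measurableSet_Iio).nullMeasurableSet
      (measure_ne_top _ _)]

variable {μ ν}

theorem isProbabilityMeasure_of_mem_couplings [IsProbabilityMeasure μ] {π : Measure (ℝ × ℝ)}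
    (hπ : π ∈ couplings μ ν) : IsProbabilityMeasure π := by
  constructor
  have h := measure_univ (μ := μ)
  rwa [← hπ.1, Measure.map_apply measurable_fst MeasurableSet.univ, preimage_univ] at h

theorem measure_Iio_sub_le_of_mem_couplings {π : Measure (ℝ × ℝ)}
    (hπ : π ∈ couplings μ ν) (a b : ℝ) :
    μ (Iio a) - ν (Iio b) ≤ π {p | p.1 < a ∧ b ≤ p.2} := by
  have hset : {p : ℝ × ℝ | p.1 < a ∧ b ≤ p.2} = (Prod.fst ⁻¹' Iio a) \ (Prod.snd ⁻¹' Iio b) := by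
    ext p
    simp
  rw [hset, ← hπ.1, ← hπ.2, Measure.map_apply measurable_fst measurableSet_Iio,
    Measure.map_apply measurable_snd measurableSet_Iio]
  exact le_measure_sdiff

theorem map_swap_mem_couplings {π : Measure (ℝ × ℝ)} (hπ : π ∈ couplings μ ν) :
    π.map Prod.swap ∈ couplings ν μ := by
  constructor
  · rw [Measure.map_map measurable_fst measurable_swap]
    exact hπ.2
  · rw [Measure.map_map measurable_snd measurable_swap]
    exact hπ.1

theorem measure_Iio_sub_le_of_mem_couplings' {π : Measure (ℝ × ℝ)}
    (hπ : π ∈ couplings μ ν) (a b : ℝ) :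
    ν (Iio a) - μ (Iio b) ≤ π {p | p.2 < a ∧ b ≤ p.1} := by
  refine (measure_Iio_sub_le_of_mem_couplings (map_swap_mem_couplings hπ) a b).trans_eq ?_
  rw [Measure.map_apply measurable_swap]
  · rfl
  · exact measurableSet_setOf_lt_and_le (by fun_prop) (by fun_prop) (by fun_prop) (by fun_prop)

/-- In one dimension the quadratic transportation cost is attained by the monotone coupling. -/
theorem transportCost_eq_lintegral_quantile (μ ν : Measure ℝ) [IsProbabilityMeasure μ]
    [IsProbabilityMeasure ν] :
    transportCost μ ν = ∫⁻ u, ENNReal.ofReal (|quantile μ u - quantile ν u| ^ 2) := by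
  have hm : Measurable fun u => (quantile μ u, quantile ν u) :=
    (measurable_quantile μ).prodMk (measurable_quantile ν)
  set π₀ : Measure (ℝ × ℝ) := volume.map fun u => (quantile μ u, quantile ν u) with hπ₀
  have hcost : ∫⁻ p, ENNReal.ofReal (|p.1 - p.2| ^ 2) ∂π₀ =
      ∫⁻ u, ENNReal.ofReal (|quantile μ u - quantile ν u| ^ 2) :=
    lintegral_map (by fun_prop) hm
  have hmem : π₀ ∈ couplings μ ν := by
    constructor
    · rw [hπ₀, Measure.map_map measurable_fst hm]
      exact map_quantile μ
    · rw [hπ₀, Measure.map_map measurable_snd hm]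
      exact map_quantile ν
  rw [← hcost]
  refine le_antisymm (iInf₂_le π₀ hmem) (le_iInf₂ fun π hπ => ?_)
  have := isProbabilityMeasure_of_mem_couplings hmem
  have := isProbabilityMeasure_of_mem_couplings hπ
  rw [lintegral_abs_sub_sq, lintegral_abs_sub_sq]
  refine add_le_add (lintegral_mono fun z => ?_) (lintegral_mono fun z => ?_)
  · refine le_trans ?_ (measure_Iio_sub_le_of_mem_couplings hπ _ _)
    rw [hπ₀, Measure.map_apply hm
      (measurableSet_setOf_lt_and_le (by fun_prop) (by fun_prop) (by fun_prop) (by fun_prop))]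
    exact volume_lt_and_le_quantile_le μ ν _ _
  · refine le_trans ?_ (measure_Iio_sub_le_of_mem_couplings' hπ _ _)
    rw [hπ₀, Measure.map_apply hm
      (measurableSet_setOf_lt_and_le (by fun_prop) (by fun_prop) (by fun_prop) (by fun_prop))]
    exact volume_lt_and_le_quantile_le ν μ _ _

end Quantile

/-! ### Isometric embeddings into `L²(0, 1)` and of the real line -/

section Embedding

instance (μ : W₂Space) : IsProbabilityMeasure μ.toMeasure :=
  inferInstanceAs (IsProbabilityMeasure (μ.1 : Measure ℝ))

theorem memLp_quantile (μ : W₂Space) : MemLp (quantile μ.toMeasure) 2 := by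
  rw [memLp_two_iff_integrable_sq (measurable_quantile _).aestronglyMeasurable]
  have h : Integrable (fun x : ℝ => x ^ 2) (volume.map (quantile μ.toMeasure)) := by
    rw [map_quantile]
    exact μ.2
  exact h.comp_measurable (measurable_quantile _)

/-- The embedding of `W₂Space` into `L²(0, 1)` by quantile functions. -/
def quantileLp (μ : W₂Space) : Lp ℝ 2 (volume : Measure UnitIoo) := (memLp_quantile μ).toLp _

theorem W₂_eq_norm_sub (μ ν : W₂Space) : W₂ μ ν = ‖quantileLp μ - quantileLp ν‖ := by
  rw [W₂, transportCost_eq_lintegral_quantile, quantileLp, quantileLp, ← MemLp.toLp_sub,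
    Lp.norm_toLp, eLpNorm_eq_lintegral_rpow_enorm_toReal two_ne_zero ENNReal.ofNat_ne_top,
    Real.sqrt_eq_rpow, ← ENNReal.toReal_rpow]
  congr 2
  refine lintegral_congr fun u => ?_
  simp only [Pi.sub_apply, Real.enorm_eq_ofReal_abs, ENNReal.toReal_ofNat, ENNReal.rpow_ofNat]
  rw [ENNReal.ofReal_pow (abs_nonneg _)]

/-- A measure is recovered as the image of Lebesgue measure under its quantile function, which need
only be known almost everywhere. -/
theorem quantileLp_injective : Function.Injective quantileLp := by
  intro μ ν h
  have hae := (MemLp.toLp_eq_toLp_iff (memLp_quantile μ) (memLp_quantile ν)).1 h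
  have hm : volume.map (quantile μ.toMeasure) = volume.map (quantile ν.toMeasure) :=
    Measure.map_congr hae
  rw [map_quantile, map_quantile] at hm
  exact Subtype.ext (Subtype.ext hm)

/-- The point mass at `a`. -/
def diracPoint (a : ℝ) : W₂Space :=
  ⟨⟨Measure.dirac a, inferInstance⟩, integrable_dirac (by simp)⟩

theorem quantile_dirac_ae (a : ℝ) : ∀ᵐ u, quantile (Measure.dirac a) u = a := by
  have h : ∀ᵐ x ∂(volume.map (quantile (Measure.dirac a))), x = a := by
    rw [map_quantile, ae_dirac_eq]
    rfl
  exact ae_of_ae_map (measurable_quantile _).aemeasurable h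

theorem W₂_diracPoint (a b : ℝ) : W₂ (diracPoint a) (diracPoint b) = |a - b| := by
  rw [W₂, transportCost_eq_lintegral_quantile]
  have e : ∫⁻ u, ENNReal.ofReal (|quantile (diracPoint a).toMeasure u -
      quantile (diracPoint b).toMeasure u| ^ 2) = ENNReal.ofReal (|a - b| ^ 2) := by
    have h : ∀ᵐ u, ENNReal.ofReal (|quantile (diracPoint a).toMeasure u -
        quantile (diracPoint b).toMeasure u| ^ 2) = ENNReal.ofReal (|a - b| ^ 2) := by
      filter_upwards [quantile_dirac_ae a, quantile_dirac_ae b] with u ha hb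
      change ENNReal.ofReal (|quantile (Measure.dirac a) u - quantile (Measure.dirac b) u| ^ 2) = _
      rw [ha, hb]
    rw [lintegral_congr_ae h]
    simp
  rw [e, ENNReal.toReal_ofReal (by positivity), Real.sqrt_sq (abs_nonneg _)]

theorem diracPoint_injective : Function.Injective diracPoint := by
  intro a b h
  have := W₂_diracPoint a b
  rw [h, W₂_diracPoint, sub_self, abs_zero] at this
  exact sub_eq_zero.1 (abs_eq_zero.1 this.symm)

end Embedding

end WassersteinKernel

end

/-! ### The admissible exponents -/

namespace WassersteinKernel

theorem negativeInequality_W₂ {H : ℝ} (h0 : 0 ≤ H) (h1 : H ≤ 1) :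
    NegativeInequality (kernelPow W₂ (2 * H)) := by
  intro n x c hsum
  simp only [kernelPow, W₂_eq_norm_sub]
  rcases h0.eq_or_lt with rfl | h0
  · simp only [mul_zero, Real.rpow_zero, mul_one, ← Finset.sum_mul_sum, hsum, le_refl]
  rcases h1.eq_or_lt with rfl | h1
  · simp only [mul_one, Real.rpow_two]
    rw [sum_mul_norm_sub_sq (fun i => quantileLp (x i)) hsum]
    nlinarith [sq_nonneg ‖∑ i, c i • quantileLp (x i)‖]
  · exact sum_mul_norm_sub_rpow_nonpos h0 h1 (fun i => quantileLp (x i)) hsum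

theorem strictNegativeInequality_W₂ {H : ℝ} (h0 : 0 < H) (h1 : H < 1) :
    StrictNegativeInequality (kernelPow W₂ (2 * H)) := by
  intro n x c hx hc hsum
  simp only [kernelPow, W₂_eq_norm_sub]
  exact sum_mul_norm_sub_rpow_neg h0 h1 (quantileLp_injective.comp hx) hc hsum

theorem W₂_self (μ : W₂Space) : W₂ μ μ = 0 := by
  rw [W₂_eq_norm_sub, sub_self, norm_zero]

theorem kernelPow_W₂_self {s : ℝ} (hs : s ≠ 0) (μ : W₂Space) : kernelPow W₂ s μ μ = 0 := by
  rw [kernelPow, W₂_self, Real.zero_rpow hs]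

theorem kernelPow_W₂_diracPoint (s a b : ℝ) :
    kernelPow W₂ s (diracPoint a) (diracPoint b) = |a - b| ^ s := by
  rw [kernelPow, W₂_diracPoint]

theorem sum_three_kernelPow_W₂ {s : ℝ} (hs : s ≠ 0) (a c : Fin 3 → ℝ) :
    ∑ i, ∑ j, c i * c j * kernelPow W₂ s (diracPoint (a i)) (diracPoint (a j)) =
      2 * (c 0 * c 1 * |a 0 - a 1| ^ s + c 0 * c 2 * |a 0 - a 2| ^ s +
        c 1 * c 2 * |a 1 - a 2| ^ s) := by
  simp only [Fin.sum_univ_three, kernelPow_W₂_diracPoint, sub_self, abs_zero, Real.zero_rpow hs,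
    abs_sub_comm (a 1) (a 0), abs_sub_comm (a 2) (a 0), abs_sub_comm (a 2) (a 1)]
  ring

/-- Second-difference weights: the value is zero at `s = 2`, which gives degeneracy, and positive
for `s > 2`. -/
theorem sum_equally_spaced_kernelPow_W₂ {s : ℝ} (hs : s ≠ 0) :
    ∑ i, ∑ j, (![1, -2, 1] : Fin 3 → ℝ) i * (![1, -2, 1] : Fin 3 → ℝ) j *
      kernelPow W₂ s (diracPoint (![0, 1, 2] i)) (diracPoint (![0, 1, 2] j)) =
      2 * ((2 : ℝ) ^ s - 4) := by
  rw [sum_three_kernelPow_W₂ hs]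
  norm_num [Matrix.cons_val_two]
  ring

theorem not_negativeInequality_W₂_of_neg {H : ℝ} (hH : H < 0) :
    ¬ NegativeInequality (kernelPow W₂ (2 * H)) := by
  intro h
  have hlim : Filter.Tendsto (fun r : ℝ => r ^ (2 * H)) Filter.atTop (nhds 0) := by
    simpa using tendsto_rpow_neg_atTop (y := -(2 * H)) (by linarith)
  -- Two points at distance `1` and a remote third one: half the form is `1 - 2 (1 + r) ^ (2 * H) -
  -- 2 r ^ (2 * H) ≥ 1 - 4 r ^ (2 * H)`, hence the threshold `1 / 4`.
  obtain ⟨r, hr, hr0⟩ := ((hlim.eventually (gt_mem_nhds (show (0 : ℝ) < 1 / 4 by norm_num))).and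
    (Filter.eventually_gt_atTop 0)).exists
  have hle : (1 + r) ^ (2 * H) ≤ r ^ (2 * H) :=
    Real.rpow_le_rpow_of_nonpos hr0 (by linarith) (by linarith)
  have := h 3 (fun i => diracPoint (![0, 1, 1 + r] i)) ![1, 1, -2]
    (by norm_num [Fin.sum_univ_three, Matrix.cons_val_two])
  rw [sum_three_kernelPow_W₂ (by linarith)] at this
  have habs : |-r + -1| = 1 + r := by
    rw [abs_of_neg (by linarith)]
    ring
  simp [abs_of_pos hr0, habs] at this
  linarith

theorem not_negativeInequality_W₂_of_one_lt {H : ℝ} (hH : 1 < H) :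
    ¬ NegativeInequality (kernelPow W₂ (2 * H)) := by
  intro h
  have := h 3 (fun i => diracPoint (![0, 1, 2] i)) ![1, -2, 1]
    (by norm_num [Fin.sum_univ_three, Matrix.cons_val_two])
  rw [sum_equally_spaced_kernelPow_W₂ (by linarith)] at this
  have h4 : (2 : ℝ) ^ (2 : ℝ) < 2 ^ (2 * H) :=
    Real.rpow_lt_rpow_of_exponent_lt one_lt_two (by linarith)
  norm_num at h4
  linarith

theorem negativeInequality_W₂_iff (H : ℝ) :
    NegativeInequality (kernelPow W₂ (2 * H)) ↔ 0 ≤ H ∧ H ≤ 1 :=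
  ⟨fun h => ⟨le_of_not_gt fun hH => not_negativeInequality_W₂_of_neg hH h,
    le_of_not_gt fun hH => not_negativeInequality_W₂_of_one_lt hH h⟩,
    fun h => negativeInequality_W₂ h.1 h.2⟩

theorem isNegativeDefinite_W₂_iff {H : ℝ} (hH : H ≠ 0) :
    IsNegativeDefinite (kernelPow W₂ (2 * H)) ↔ 0 ≤ H ∧ H ≤ 1 := by
  rw [IsNegativeDefinite, negativeInequality_W₂_iff]
  exact and_iff_right fun μ => kernelPow_W₂_self (mul_ne_zero two_ne_zero hH) μ

theorem not_strictNegativeInequality_W₂_zero :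
    ¬ StrictNegativeInequality (kernelPow W₂ (2 * 0)) := by
  intro h
  have hinj : Function.Injective (![0, 1] : Fin 2 → ℝ) := by
    intro i j
    fin_cases i <;> fin_cases j <;> simp
  have := h 2 (fun i => diracPoint (![0, 1] i)) ![1, -1] (diracPoint_injective.comp hinj)
    (fun h => by simpa using congrFun h 0) (by simp)
  simp [kernelPow] at this

theorem not_strictNegativeInequality_W₂_one :
    ¬ StrictNegativeInequality (kernelPow W₂ (2 * 1)) := by
  intro h
  have hinj : Function.Injective (![0, 1, 2] : Fin 3 → ℝ) := by
    intro i j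
    fin_cases i <;> fin_cases j <;> simp
  have := h 3 (fun i => diracPoint (![0, 1, 2] i)) ![1, -2, 1] (diracPoint_injective.comp hinj)
    (fun h => by simpa using congrFun h 0)
    (by norm_num [Fin.sum_univ_three, Matrix.cons_val_two])
  rw [sum_equally_spaced_kernelPow_W₂ (by norm_num)] at this
  norm_num at this

theorem negativeInequality_and_strict_W₂_iff (H : ℝ) :
    (NegativeInequality (kernelPow W₂ (2 * H)) ∧
      StrictNegativeInequality (kernelPow W₂ (2 * H))) ↔ 0 < H ∧ H < 1 := by
  refine ⟨fun ⟨h, hs⟩ => ?_, fun h =>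
    ⟨negativeInequality_W₂ h.1.le h.2.le, strictNegativeInequality_W₂ h.1 h.2⟩⟩
  obtain ⟨h0, h1⟩ := (negativeInequality_W₂_iff H).1 h
  refine ⟨h0.lt_of_ne ?_, h1.lt_of_ne ?_⟩
  · rintro rfl
    exact not_strictNegativeInequality_W₂_zero hs
  · rintro rfl
    exact not_strictNegativeInequality_W₂_one hs

theorem isNondegenerateNegativeDefinite_W₂_iff (H : ℝ) :
    IsNondegenerateNegativeDefinite (kernelPow W₂ (2 * H)) ↔ 0 < H ∧ H < 1 := by
  rw [← negativeInequality_and_strict_W₂_iff]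
  refine ⟨fun h => ⟨h.1.2, h.2⟩, fun h => ⟨⟨fun μ => kernelPow_W₂_self ?_ μ, h.1⟩, h.2⟩⟩
  have := ((negativeInequality_and_strict_W₂_iff H).1 h).1
  positivity

theorem fractionalIndex_W₂ : fractionalIndex W₂ = 2 := by
  have hiff : ∀ β : ℝ, 0 < β → (IsNegativeDefinite (kernelPow W₂ β) ↔ β ≤ 2) := by
    intro β hβ
    have h := isNegativeDefinite_W₂_iff (H := β / 2) (by positivity)
    rw [mul_div_cancel₀ β two_ne_zero] at h
    rw [h]
    constructor
    · rintro ⟨-, h⟩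
      linarith
    · intro h
      constructor <;> linarith
  refine le_antisymm (iSup₂_le fun β hβ => ?_) ?_
  · rw [← ENNReal.ofReal_ofNat 2]
    exact ENNReal.ofReal_le_ofReal ((hiff β hβ.1).1 hβ.2)
  · rw [← ENNReal.ofReal_ofNat 2]
    exact le_iSup₂_of_le (2 : ℝ) ⟨two_pos, (hiff 2 two_pos).2 le_rfl⟩ le_rfl

end WassersteinKernel

theorem mainTheorem1 :
    -- the defining inequality, for every real `H`
    (∀ H : ℝ, WassersteinKernel.NegativeInequality
        (WassersteinKernel.kernelPow WassersteinKernel.W₂ (2 * H)) ↔ 0 ≤ H ∧ H ≤ 1) ∧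
    -- the same with the vanishing on the diagonal, which excludes only the constant kernel `H = 0`
    (∀ H : ℝ, H ≠ 0 → (WassersteinKernel.IsNegativeDefinite
        (WassersteinKernel.kernelPow WassersteinKernel.W₂ (2 * H)) ↔ 0 ≤ H ∧ H ≤ 1)) ∧
    -- nondegeneracy, without and with the vanishing on the diagonal
    (∀ H : ℝ, (WassersteinKernel.NegativeInequality
        (WassersteinKernel.kernelPow WassersteinKernel.W₂ (2 * H)) ∧
      WassersteinKernel.StrictNegativeInequality
        (WassersteinKernel.kernelPow WassersteinKernel.W₂ (2 * H))) ↔ 0 < H ∧ H < 1) ∧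
    (∀ H : ℝ, WassersteinKernel.IsNondegenerateNegativeDefinite
        (WassersteinKernel.kernelPow WassersteinKernel.W₂ (2 * H)) ↔ 0 < H ∧ H < 1) ∧
    -- the fractional index
    WassersteinKernel.fractionalIndex WassersteinKernel.W₂ = 2 := by
  exact ⟨WassersteinKernel.negativeInequality_W₂_iff,
    fun _ hH => WassersteinKernel.isNegativeDefinite_W₂_iff hH,
    WassersteinKernel.negativeInequality_and_strict_W₂_iff,
    WassersteinKernel.isNondegenerateNegativeDefinite_W₂_iff,
    WassersteinKernel.fractionalIndex_W₂⟩
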